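/- For a topological space $X$ let $\mathrm{Sub}_n(X)$ be the space of nonempty subsets of $X$ with at most $n$ elements (with the Vietoris topology; for compact Hausdorff $X$ this is the quotient topology from $X^n\to\mathrm{Sub}_n(X)$, $(x_1,\dots,x_n)\mapsto\{x_1,\dots,x_n\}$), so that $\mathrm{Sub}_1(X)\subset \mathrm{Sub}_2(X)\subset \mathrm{Sub}_3(X)$ are subspaces. Let $S^3=\{(u,w)\in\mathbb{C}^2 : |u|^2+|w|^2=1\}$, and let $T=\{(u,w)\in S^3 : u^3=w^2\}$ be the trefoil knot. The Möbius band is $M=[0,1]^2/\bigl((0,y)\sim(1,1-y)\bigr)$; its boundary $\partial M$ is the image of $[0,1]\times\{0,1\}$. **Theorem (Borsuk-Bott-Reader-Mostovoy).** There is a homeomorphism $h\colon \mathrm{Sub}_3(S^1)\to S^3$ such that $h(\mathrm{Sub}_1(S^1))=T$, and such that $h(\mathrm{Sub}_2(S^1))$ is a Möbius band with boundary $T$: there is a topological embedding $f\colon M\to S^3$ with $f(M)=h(\mathrm{Sub}_2(S^1))$ and $f(\partial M)=T$. -/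

import Mathlib

open Set Topology TopologicalSpace

/-- The space `Sub_n(X)` of nonempty subsets of `X` with at most `n` elements, as a subspace of the
hyperspace of nonempty compact subsets of `X` with its (Vietoris) topology. In particular
`Sub_1(X) ⊆ Sub_2(X) ⊆ Sub_3(X) ⊆ ⋯` are subspaces of each other. -/
def FinSub (n : ℕ) (X : Type*) [TopologicalSpace X] : Set (NonemptyCompacts X) :=
  {K | (K : Set X).encard ≤ n}

/-- The `3`-sphere `{(u, w) ∈ ℂ² : |u|² + |w|² = 1}`. -/
abbrev S3 : Set (EuclideanSpace ℂ (Fin 2)) := Metric.sphere 0 1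

/-- The trefoil knot: the curve `u³ = w²` in the `3`-sphere. -/
def trefoilKnot : Set S3 := {p | p.1 0 ^ 3 = p.1 1 ^ 2}

/-- The gluing of the left edge of the unit square to the right edge with a flip:
`(0, y)` is glued to `(1, 1 - y)`. -/
def MoebiusGlue (p q : unitInterval × unitInterval) : Prop :=
  p.1 = 0 ∧ q.1 = 1 ∧ q.2 = unitInterval.symm p.2

/-- The (closed) Möbius band: the quotient of the unit square by the equivalence relation that
`MoebiusGlue` generates. -/
def MoebiusBand : Type := Quot MoebiusGlue

/-- The Möbius band carries the quotient topology. -/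
instance : TopologicalSpace MoebiusBand := inferInstanceAs (TopologicalSpace (Quot MoebiusGlue))

/-- The boundary circle of the Möbius band: the image of the two horizontal edges of the square. -/
def moebiusBoundary : Set MoebiusBand :=
  Quot.mk MoebiusGlue '' {p | p.2 = 0 ∨ p.2 = 1}

/-! Both `Sub_3` of the circle and the sphere are quotients of one compact parameter space with the
same fibres. Continuous surjections from a compact space to Hausdorff spaces are quotient maps, so
equal fibres give a homeomorphism.

Angles are in full turns. A set has gaps `c`, `c + s p`, `c + s (1 - p)` with `c = (1 - s) / 3`
smallest. A point `(u, w) ≠ 0` gives the roots `A`, `B` of `X² - 2wX + u³`. The action `(t² u, t³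
w)` of `t > 0` normalizes the larger one to `|A| = 1`; then `|u| = s` and `|B| = s³`. If `φ`, `ψ`
are the phases of `u`, `A`, then `p = 3φ - 2ψ` mod 1 and `θ = ψ - φ + p (1 - s) / 3`. Ambiguities
match: `p` wraps around when two gaps tie for smallest, `p` is lost at `s = 0` (equilateral triples,
`u = 0`), and at `s = 1` (at most two points, `|A| = |B|`) the points, like the roots, may be
swapped. Both fibre relations are `ParamRel`, by `paramRel_of_paramSet_eq` and
`paramRel_of_coord_eq`.

Since `w² - u³ = ((A - B) / 2)²`, the trefoil is the locus `A = B`, which is the locus of one-point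
sets. Sets of at most two points are the ends of an arc; its midpoint and length are coordinates on
a Möbius band. -/

theorem exists_homeomorph_of_ker_eq {Z X Y : Type*} [TopologicalSpace Z] [TopologicalSpace X]
    [TopologicalSpace Y] [CompactSpace Z] [T2Space X] [T2Space Y] {f : Z → X} {g : Z → Y}
    (hf : Continuous f) (hg : Continuous g) (hfs : Function.Surjective f)
    (hgs : Function.Surjective g) (h : ∀ a b, f a = f b ↔ g a = g b) :
    ∃ e : X ≃ₜ Y, ∀ z, e (f z) = g z := by
  have qf : IsQuotientMap f := hf.isClosedMap.isQuotientMap hf hfs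
  have qg : IsQuotientMap g := hg.isClosedMap.isQuotientMap hg hgs
  let F : X → Y := fun x => g (Function.surjInv hfs x)
  let G : Y → X := fun y => f (Function.surjInv hgs y)
  have hF : ∀ z, F (f z) = g z := fun z => (h _ _).1 (Function.surjInv_eq hfs _)
  have hG : ∀ z, G (g z) = f z := fun z => (h _ _).2 (Function.surjInv_eq hgs _)
  refine ⟨⟨⟨F, G, fun x => ?_, fun y => ?_⟩, ?_, ?_⟩, hF⟩
  · obtain ⟨z, rfl⟩ := hfs x
    rw [hF, hG]
  · obtain ⟨z, rfl⟩ := hgs y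
    rw [hG, hF]
  · exact qf.continuous_iff.2 (by rw [show F ∘ f = g from funext hF]; exact hg)
  · exact qg.continuous_iff.2 (by rw [show G ∘ g = f from funext hG]; exact hf)

/-! ### The circle as real angles modulo 1 -/

/-- The point of the circle at angle `θ`, measured in full turns. -/
noncomputable def circ (θ : ℝ) : Circle := Circle.exp (2 * Real.pi * θ)

theorem continuous_circ : Continuous circ := by
  unfold circ; fun_prop

theorem circ_add (a b : ℝ) : circ (a + b) = circ a * circ b := by
  simp [circ, mul_add, Circle.exp_add]

theorem circ_eq_circ {a b : ℝ} : circ a = circ b ↔ ∃ n : ℤ, a = b + n := by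
  unfold circ
  rw [Circle.exp_eq_exp]
  refine exists_congr fun n => ?_
  have := Real.pi_pos
  constructor <;> intro h
  · have : 2 * Real.pi * (a - (b + n)) = 0 := by linarith
    rcases mul_eq_zero.1 this with h | h <;> linarith
  · rw [h]; ring

theorem circ_nsmul (n : ℕ) (a : ℝ) : circ (n * a) = circ a ^ n := by
  induction n with
  | zero => simp [circ]
  | succ n ih => rw [pow_succ, ← ih, ← circ_add]; congr 1; push_cast; ring

theorem exists_circ_eq (z : Circle) : ∃ θ ∈ Ico (0 : ℝ) 1, circ θ = z := by
  obtain ⟨x, rfl⟩ := Circle.exp_surjective z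
  refine ⟨Int.fract (x / (2 * Real.pi)), ⟨Int.fract_nonneg _, Int.fract_lt_one _⟩, ?_⟩
  have h : Circle.exp x = circ (x / (2 * Real.pi)) := by
    unfold circ; congr 1; have := Real.pi_pos; field_simp
  rw [h, circ_eq_circ]
  exact ⟨-⌊x / (2 * Real.pi)⌋, by rw [Int.fract]; push_cast; ring⟩

/-! ### Parametrizing finite subsets by their gaps -/

/-- The set of the points of the circle at angles `θ`, `θ + a` and `θ - c`. -/
noncomputable def tripleSet (θ a c : ℝ) : NonemptyCompacts Circle :=
  {circ θ} ⊔ {circ (θ + a)} ⊔ {circ (θ - c)}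

theorem coe_tripleSet (θ a c : ℝ) :
    (tripleSet θ a c : Set Circle) = {circ θ, circ (θ + a), circ (θ - c)} := by
  ext x
  simp only [tripleSet, NonemptyCompacts.coe_sup, NonemptyCompacts.coe_singleton, mem_union,
    mem_insert_iff, mem_singleton_iff]
  tauto

theorem tripleSet_mem (θ a c : ℝ) : tripleSet θ a c ∈ FinSub 3 Circle := by
  change (tripleSet θ a c : Set Circle).encard ≤ (3 : ℕ)
  rw [coe_tripleSet]
  calc _ ≤ ({circ (θ + a), circ (θ - c)} : Set Circle).encard + 1 := encard_insert_le _ _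
    _ ≤ (({circ (θ - c)} : Set Circle).encard + 1) + 1 := by gcongr; exact encard_insert_le _ _
    _ = (3 : ℕ) := by rw [encard_singleton]; norm_num

/-- The set in `Sub_3` with parameters `(θ, p, s)`: its smallest gap is `(1 - s) / 3` and ends at
the angle `θ`, and `p` tells how the rest is divided between the other two gaps. -/
noncomputable def paramSet (θ p s : ℝ) : NonemptyCompacts Circle :=
  tripleSet θ ((1 - s) / 3 + s * p) ((1 - s) / 3)

theorem continuous_paramSet :
    Continuous fun q : ℝ × ℝ × ℝ => paramSet q.1 q.2.1 q.2.2 := by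
  have hc := continuous_circ
  have hs := NonemptyCompacts.continuous_singleton (α := Circle)
  unfold paramSet tripleSet
  exact ((hs.comp (hc.comp (by fun_prop))).sup (hs.comp (hc.comp (by fun_prop)))).sup
    (hs.comp (hc.comp (by fun_prop)))

/-- The identifications among the parameters `(θ, p, s)` that describe the same subset. -/
def ParamRel (θ p s θ' p' s' : ℝ) : Prop :=
  s = s' ∧ ((p = p' ∧ ∃ n : ℤ, θ' = θ + n) ∨
    (p = 0 ∧ p' = 1 ∧ ∃ n : ℤ, θ' = θ + (1 - s) / 3 + n) ∨
    (p = 1 ∧ p' = 0 ∧ ∃ n : ℤ, θ = θ' + (1 - s) / 3 + n) ∨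
    (s = 0 ∧ ∃ n : ℤ, 3 * θ' = 3 * θ + n) ∨
    (s = 1 ∧ p' = 1 - p ∧ ∃ n : ℤ, θ' = θ + p + n))

/-- With `c` the smallest gap, `s = 1 - 3c` is what remains after taking `c` from each gap, and `p`
is the share of it in `a`. If nothing remains, `p` is arbitrary. -/
theorem exists_paramSet_of_gaps {θ a c : ℝ} (hc : 0 ≤ c) (hca : c ≤ a) (h : a + 2 * c ≤ 1) :
    ∃ p s : ℝ, p ∈ Icc (0 : ℝ) 1 ∧ s ∈ Icc (0 : ℝ) 1 ∧ paramSet θ p s = tripleSet θ a c := by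
  rcases eq_or_ne (1 - 3 * c) 0 with h0 | h0
  · refine ⟨0, 0, by simp, by simp, ?_⟩
    have h1 : c = 1 / 3 := by linarith
    have h2 : a = 1 / 3 := by linarith
    simp [paramSet, h1, h2]
  · have hpos : 0 < 1 - 3 * c := lt_of_le_of_ne (by linarith) h0.symm
    refine ⟨(a - c) / (1 - 3 * c), 1 - 3 * c, ⟨div_nonneg (by linarith) hpos.le, ?_⟩,
      ⟨hpos.le, by linarith⟩, ?_⟩
    · rw [div_le_one hpos]; linarith
    · unfold paramSet
      congr 1
      · rw [mul_div_cancel₀ _ h0]; ring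
      · ring

theorem exists_paramSet_of_le {x y z : ℝ} (hxy : x ≤ y) (hyz : y ≤ z) (hzx : z ≤ x + 1) :
    ∃ θ p s : ℝ, p ∈ Icc (0 : ℝ) 1 ∧ s ∈ Icc (0 : ℝ) 1 ∧
      (paramSet θ p s : Set Circle) = {circ x, circ y, circ z} := by
  have hper : ∀ {a b : ℝ} (n : ℤ), a = b + n → circ a = circ b :=
    fun n h => circ_eq_circ.2 ⟨n, h⟩
  by_cases h1 : y - x ≤ z - y ∧ y - x ≤ x + 1 - z
  · obtain ⟨p, s, hp, hs, h⟩ := exists_paramSet_of_gaps (θ := y) (a := z - y) (c := y - x)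
      (by linarith) h1.1 (by linarith)
    refine ⟨y, p, s, hp, hs, ?_⟩
    rw [h, coe_tripleSet, show y + (z - y) = z by ring, show y - (y - x) = x by ring]
    grind
  by_cases h2 : z - y ≤ x + 1 - z ∧ z - y ≤ y - x
  · obtain ⟨p, s, hp, hs, h⟩ := exists_paramSet_of_gaps (θ := z) (a := x + 1 - z) (c := z - y)
      (by linarith) h2.1 (by linarith)
    refine ⟨z, p, s, hp, hs, ?_⟩
    rw [h, coe_tripleSet, show z - (z - y) = y by ring,
      hper (a := z + (x + 1 - z)) (b := x) 1 (by push_cast; ring)]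
    grind
  · have h3 : x + 1 - z ≤ y - x ∧ x + 1 - z ≤ z - y := by
      rw [not_and_or, not_le, not_le] at h1 h2
      constructor <;> rcases h1 with h1 | h1 <;> rcases h2 with h2 | h2 <;> linarith
    obtain ⟨p, s, hp, hs, h⟩ := exists_paramSet_of_gaps (θ := x) (a := y - x) (c := x + 1 - z)
      (by linarith) h3.1 (by linarith)
    refine ⟨x, p, s, hp, hs, ?_⟩
    rw [h, coe_tripleSet, show x + (y - x) = y by ring,
      hper (a := x - (x + 1 - z)) (b := z) (-1) (by push_cast; ring)]

theorem paramSet_add_int (θ p s : ℝ) (n : ℤ) : paramSet (θ + n) p s = paramSet θ p s := by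
  have h : ∀ a b : ℝ, a = b + n → circ a = circ b := fun a b h => circ_eq_circ.2 ⟨n, h⟩
  unfold paramSet tripleSet
  rw [h (θ + n) θ rfl, h (θ + n + _) (θ + ((1 - s) / 3 + s * p)) (by ring),
    h (θ + n - _) (θ - (1 - s) / 3) (by ring)]

theorem exists_paramSet_eq {K : NonemptyCompacts Circle} (hK : K ∈ FinSub 3 Circle) :
    ∃ θ p s : ℝ, θ ∈ Icc (0 : ℝ) 1 ∧ p ∈ Icc (0 : ℝ) 1 ∧ s ∈ Icc (0 : ℝ) 1 ∧
      paramSet θ p s = K := by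
  obtain ⟨x, y, z, hxyz⟩ : ∃ x y z, (K : Set Circle) = {x, y, z} := by
    classical
    have h : (K : Set Circle).encard ≤ (3 : ℕ) := hK
    have hfin : (K : Set Circle).Finite := finite_of_encard_le_coe h
    rw [hfin.encard_eq_coe_toFinset_card, Nat.cast_le] at h
    have hne : 0 < hfin.toFinset.card := Finset.card_pos.2 (by simpa using K.nonempty)
    have h' : hfin.toFinset.card = 1 ∨ hfin.toFinset.card = 2 ∨ hfin.toFinset.card = 3 := by omega
    rw [← hfin.coe_toFinset]
    rcases h' with h' | h' | h'
    · obtain ⟨x, hx⟩ := Finset.card_eq_one.1 h'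
      -- Repeated points are allowed: they create a zero gap, hence `s = 1`.
      exact ⟨x, x, x, by simp [hx]⟩
    · obtain ⟨x, y, -, hx⟩ := Finset.card_eq_two.1 h'
      exact ⟨x, x, y, by simp [hx]⟩
    · obtain ⟨x, y, z, -, -, -, hx⟩ := Finset.card_eq_three.1 h'
      exact ⟨x, y, z, by simp [hx]⟩
  suffices h : ∃ θ p s : ℝ, p ∈ Icc (0 : ℝ) 1 ∧ s ∈ Icc (0 : ℝ) 1 ∧
      (paramSet θ p s : Set Circle) = {x, y, z} by
    obtain ⟨θ, p, s, hp, hs, h⟩ := h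
    refine ⟨Int.fract θ, p, s, ⟨Int.fract_nonneg _, (Int.fract_lt_one _).le⟩, hp, hs, ?_⟩
    refine SetLike.coe_injective ?_
    have := paramSet_add_int (Int.fract θ) p s ⌊θ⌋
    rw [Int.fract_add_floor] at this
    rw [← this, h, hxyz]
  obtain ⟨x, hx, rfl⟩ := exists_circ_eq x
  obtain ⟨y, hy, rfl⟩ := exists_circ_eq y
  obtain ⟨z, hz, rfl⟩ := exists_circ_eq z
  have hx1 := hx.1; have hx2 := hx.2; have hy1 := hy.1; have hy2 := hy.2
  have hz1 := hz.1; have hz2 := hz.2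
  rcases le_total x y with h1 | h1 <;> rcases le_total y z with h2 | h2 <;>
    rcases le_total x z with h3 | h3
  all_goals first
    | exact exists_paramSet_of_le h1 h2 (by linarith)
    | (obtain ⟨θ, p, s, hp, hs, h⟩ := exists_paramSet_of_le h3 h2 (by linarith)
       exact ⟨θ, p, s, hp, hs, h.trans (by grind)⟩)
    | (obtain ⟨θ, p, s, hp, hs, h⟩ := exists_paramSet_of_le h3 h1 (by linarith)
       exact ⟨θ, p, s, hp, hs, h.trans (by grind)⟩)
    | (obtain ⟨θ, p, s, hp, hs, h⟩ := exists_paramSet_of_le h1 h3 (by linarith)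
       exact ⟨θ, p, s, hp, hs, h.trans (by grind)⟩)
    | (obtain ⟨θ, p, s, hp, hs, h⟩ := exists_paramSet_of_le h2 h3 (by linarith)
       exact ⟨θ, p, s, hp, hs, h.trans (by grind)⟩)
    | (obtain ⟨θ, p, s, hp, hs, h⟩ := exists_paramSet_of_le h2 h1 (by linarith)
       exact ⟨θ, p, s, hp, hs, h.trans (by grind)⟩)

/-- At `p = 0` the gap after `θ` is also smallest, so its end `θ + (1 - s) / 3` serves as base point
with `p = 1`. At `s = 0` rotation by a third preserves the set; at `s = 1` either of the points `θ`,
`θ + p` can be the base. -/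
theorem paramSet_eq_of_paramRel {θ p s θ' p' s' : ℝ} (h : ParamRel θ p s θ' p' s') :
    paramSet θ p s = paramSet θ' p' s' := by
  have hper : ∀ {a b : ℝ} (n : ℤ), a = b + n → circ a = circ b :=
    fun n h => circ_eq_circ.2 ⟨n, h⟩
  have glue : ∀ θ s : ℝ, paramSet θ 0 s = paramSet (θ + (1 - s) / 3) 1 s := by
    intro θ s
    apply SetLike.coe_injective
    unfold paramSet
    rw [coe_tripleSet, coe_tripleSet,
      hper (a := θ + (1 - s) / 3 + ((1 - s) / 3 + s * 1)) (b := θ - (1 - s) / 3) 1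
        (by push_cast; ring), add_sub_cancel_right, mul_zero, add_zero]
    grind
  obtain ⟨rfl, h⟩ := h
  rcases h with ⟨rfl, n, rfl⟩ | ⟨rfl, rfl, n, rfl⟩ | ⟨rfl, rfl, n, rfl⟩ | ⟨rfl, n, h⟩ |
    ⟨rfl, rfl, n, rfl⟩
  · rw [paramSet_add_int]
  · rw [paramSet_add_int, glue]
  · rw [paramSet_add_int, glue]
  · have key : ∀ q : ℝ, paramSet θ' q 0 = tripleSet θ' (1 / 3) (1 / 3) := fun q => by
      simp [paramSet]
    have key' : ∀ q : ℝ, paramSet θ q 0 = tripleSet θ (1 / 3) (1 / 3) := fun q => by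
      simp [paramSet]
    rw [key, key']
    apply SetLike.coe_injective
    rw [coe_tripleSet, coe_tripleSet]
    obtain ⟨k, hk | hk | hk⟩ : ∃ k : ℤ, n = 3 * k ∨ n = 3 * k + 1 ∨ n = 3 * k + 2 :=
      ⟨n / 3, by omega⟩
    · have hk' : (n : ℝ) = 3 * k := by exact_mod_cast hk
      rw [hper (a := θ') (b := θ) k (by linarith),
        hper (a := θ' + 1 / 3) (b := θ + 1 / 3) k (by linarith),
        hper (a := θ' - 1 / 3) (b := θ - 1 / 3) k (by linarith)]
    · have hk' : (n : ℝ) = 3 * k + 1 := by exact_mod_cast hk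
      rw [hper (a := θ') (b := θ + 1 / 3) k (by linarith),
        hper (a := θ' + 1 / 3) (b := θ - 1 / 3) (k + 1) (by push_cast; linarith),
        hper (a := θ' - 1 / 3) (b := θ) k (by linarith)]
      grind
    · have hk' : (n : ℝ) = 3 * k + 2 := by exact_mod_cast hk
      rw [hper (a := θ') (b := θ - 1 / 3) (k + 1) (by push_cast; linarith),
        hper (a := θ' + 1 / 3) (b := θ) (k + 1) (by push_cast; linarith),
        hper (a := θ' - 1 / 3) (b := θ + 1 / 3) k (by linarith)]
      grind
  · rw [paramSet_add_int]
    apply SetLike.coe_injective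
    unfold paramSet
    rw [coe_tripleSet, coe_tripleSet]
    simp only [sub_self, zero_div, zero_add, one_mul, sub_zero]
    rw [hper (a := θ + p + (1 - p)) (b := θ) 1 (by push_cast; ring)]
    grind

/-! ### When two parameters give the same subset -/

theorem int_eq_zero_of_lt {n : ℤ} (h1 : (-1 : ℝ) < n) (h2 : (n : ℝ) < 1) : n = 0 := by
  have h1' : -1 < n := by exact_mod_cast h1
  have h2' : n < 1 := by exact_mod_cast h2
  omega

theorem int_eq_one_of_lt {n : ℤ} (h1 : (0 : ℝ) < n) (h2 : (n : ℝ) < 2) : n = 1 := by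
  have h1' : 0 < n := by exact_mod_cast h1
  have h2' : n < 2 := by exact_mod_cast h2
  omega

/-- The gaps of a genuine triple, listed from a point of the circle, determine it up to
cyclic rotation. -/
theorem tripleSet_eq_cases {θ a c θ' a' c' : ℝ} (hc : 0 < c) (hca : c ≤ a) (h : a + 2 * c ≤ 1)
    (hc' : 0 < c') (hca' : c' ≤ a') (h' : a' + 2 * c' ≤ 1)
    (H : tripleSet θ a c = tripleSet θ' a' c') :
    (a' = a ∧ c' = c ∧ ∃ n : ℤ, θ' = θ + n) ∨
    (a' = 1 - a - c ∧ c' = a ∧ ∃ n : ℤ, θ' = θ + a + n) ∨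
    (a' = c ∧ c' = 1 - a - c ∧ ∃ n : ℤ, θ' = θ - c + n) := by
  have H' : ({circ θ, circ (θ + a), circ (θ - c)} : Set Circle) =
      {circ θ', circ (θ' + a'), circ (θ' - c')} := by
    rw [← coe_tripleSet, ← coe_tripleSet, H]
  have hx : circ θ' ∈ ({circ θ, circ (θ + a), circ (θ - c)} : Set Circle) := by simp [H']
  have hy : circ (θ' + a') ∈ ({circ θ, circ (θ + a), circ (θ - c)} : Set Circle) := by simp [H']
  have hz : circ (θ' - c') ∈ ({circ θ, circ (θ + a), circ (θ - c)} : Set Circle) := by simp [H']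
  have hxy : circ θ' ≠ circ (θ' + a') := fun e => by
    obtain ⟨n, hn⟩ := circ_eq_circ.1 e
    have := int_eq_zero_of_lt (n := n) (by linarith) (by linarith)
    subst this; push_cast at hn; linarith
  have hxz : circ θ' ≠ circ (θ' - c') := fun e => by
    obtain ⟨n, hn⟩ := circ_eq_circ.1 e
    have := int_eq_zero_of_lt (n := n) (by linarith) (by linarith)
    subst this; push_cast at hn; linarith
  have hyz : circ (θ' + a') ≠ circ (θ' - c') := fun e => by
    obtain ⟨n, hn⟩ := circ_eq_circ.1 e
    have := int_eq_zero_of_lt (n := n) (by linarith) (by linarith)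
    subst this; push_cast at hn; linarith
  simp only [mem_insert_iff, mem_singleton_iff] at hx hy hz
  -- Six matchings of the points are injective. The gap bounds fix the integer lifts; the three
  -- matchings that reverse orientation violate these bounds, leaving the three rotations.
  rcases hx with hx | hx | hx <;> rcases hy with hy | hy | hy <;>
    first
    | exact absurd (hx.trans hy.symm) hxy
    | (rcases hz with hz | hz | hz <;>
        first
        | exact absurd (hx.trans hz.symm) hxz
        | exact absurd (hy.trans hz.symm) hyz
        | (obtain ⟨i, hi⟩ := circ_eq_circ.1 hx
           obtain ⟨j, hj⟩ := circ_eq_circ.1 hy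
           obtain ⟨k, hk⟩ := circ_eq_circ.1 hz
           have e1 : ((j - i : ℤ) : ℝ) = j - i := by push_cast; ring
           have e2 : ((i - k : ℤ) : ℝ) = i - k := by push_cast; ring
           have hm : j - i = 0 ∨ j - i = 1 := by
             first
             | exact Or.inl (int_eq_zero_of_lt (by linarith) (by linarith))
             | exact Or.inr (int_eq_one_of_lt (by linarith) (by linarith))
           have hl : i - k = 0 ∨ i - k = 1 := by
             first
             | exact Or.inl (int_eq_zero_of_lt (by linarith) (by linarith))
             | exact Or.inr (int_eq_one_of_lt (by linarith) (by linarith))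
           rcases hm with hm | hm <;> rcases hl with hl | hl <;> rw [hm] at e1 <;> rw [hl] at e2 <;>
             push_cast at e1 e2 <;>
             first
             | (exfalso; linarith)
             | exact Or.inl ⟨by linarith, by linarith, i, hi⟩
             | exact Or.inr (Or.inl ⟨by linarith, by linarith, i, hi⟩)
             | exact Or.inr (Or.inr ⟨by linarith, by linarith, i, hi⟩)))

theorem coe_paramSet_one (θ p : ℝ) :
    (paramSet θ p 1 : Set Circle) = {circ θ, circ (θ + p)} := by
  unfold paramSet
  rw [coe_tripleSet]
  simp only [sub_self, zero_div, zero_add, one_mul, sub_zero]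
  grind

/-- For `s' < 1` all gaps are positive and the three points are distinct, whereas `s = 1` leaves at
most two. -/
theorem paramSet_one_ne {θ p θ' p' s' : ℝ} (hp' : p' ∈ Icc (0 : ℝ) 1) (hs' : s' ∈ Ico (0 : ℝ) 1) :
    paramSet θ p 1 ≠ paramSet θ' p' s' := by
  intro H
  have H' := congrArg (fun K : NonemptyCompacts Circle => (K : Set Circle)) H
  simp only [coe_paramSet_one] at H'
  have h1 := mul_nonneg hs'.1 hp'.1
  have h2 := mul_nonneg hs'.1 (sub_nonneg.2 hp'.2)
  have h3 := hs'.2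
  have hs0 := hs'.1
  unfold paramSet at H'
  rw [coe_tripleSet] at H'
  set c' := (1 - s') / 3 with hc'
  set a' := c' + s' * p' with ha'
  have hx : circ θ' ∈ ({circ θ, circ (θ + p)} : Set Circle) := by simp [H']
  have hy : circ (θ' + a') ∈ ({circ θ, circ (θ + p)} : Set Circle) := by simp [H']
  have hz : circ (θ' - c') ∈ ({circ θ, circ (θ + p)} : Set Circle) := by simp [H']
  have hxy : circ θ' ≠ circ (θ' + a') := fun e => by
    obtain ⟨n, hn⟩ := circ_eq_circ.1 e
    have := int_eq_zero_of_lt (n := n) (by linarith) (by linarith)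
    subst this; push_cast at hn; linarith
  have hxz : circ θ' ≠ circ (θ' - c') := fun e => by
    obtain ⟨n, hn⟩ := circ_eq_circ.1 e
    have := int_eq_zero_of_lt (n := n) (by linarith) (by linarith)
    subst this; push_cast at hn; linarith
  have hyz : circ (θ' + a') ≠ circ (θ' - c') := fun e => by
    obtain ⟨n, hn⟩ := circ_eq_circ.1 e
    have := int_eq_zero_of_lt (n := n) (by linarith) (by linarith)
    subst this; push_cast at hn; linarith
  grind

theorem int_cases_of_le {n : ℤ} (h1 : (0 : ℝ) ≤ n) (h2 : (n : ℝ) ≤ 2) :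
    n = 0 ∨ n = 1 ∨ n = 2 := by
  have h1' : 0 ≤ n := by exact_mod_cast h1
  have h2' : n ≤ 2 := by exact_mod_cast h2
  omega

/-- The parameters of the same two-point set whose angles add up to an integer. -/
theorem paramRel_one_of_add_int {θ p θ' p' : ℝ} (hp : p ∈ Icc (0 : ℝ) 1)
    (hp' : p' ∈ Icc (0 : ℝ) 1) {m n : ℤ} (hm : p + p' = m) (hθ : θ' = θ + p + n) :
    ParamRel θ p 1 θ' p' 1 := by
  have := hp.1; have := hp.2; have := hp'.1; have := hp'.2
  refine ⟨rfl, ?_⟩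
  rcases int_cases_of_le (n := m) (by linarith) (by linarith) with rfl | rfl | rfl <;>
    push_cast at hm
  · exact Or.inl ⟨by linarith, n, by linarith⟩
  · exact Or.inr (Or.inr (Or.inr (Or.inr ⟨rfl, by linarith, n, hθ⟩)))
  · exact Or.inl ⟨by linarith, n + 1, by push_cast; linarith⟩

/-- The parameters of the same two-point set whose angles differ by an integer. -/
theorem paramRel_of_sub_int {s θ p θ' p' : ℝ} (hp : p ∈ Icc (0 : ℝ) 1)
    (hp' : p' ∈ Icc (0 : ℝ) 1) {m n : ℤ} (hm : p - p' = m)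
    (hθ : θ' = θ - (p - p') * (1 - s) / 3 + n) :
    ParamRel θ p s θ' p' s := by
  have := hp.1; have := hp.2; have := hp'.1; have := hp'.2
  refine ⟨rfl, ?_⟩
  have e : ((m + 1 : ℤ) : ℝ) = m + 1 := by push_cast; ring
  rcases int_cases_of_le (n := m + 1) (by linarith) (by linarith) with h | h | h <;>
    rw [h] at e <;> push_cast at e
  · have h0 : p = 0 := by linarith
    have h1 : p' = 1 := by linarith
    subst h0 h1
    exact Or.inr (Or.inl ⟨rfl, rfl, n, by linarith⟩)
  · have h0 : p = p' := by linarith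
    subst h0
    exact Or.inl ⟨rfl, n, by linarith⟩
  · have h0 : p = 1 := by linarith
    have h1 : p' = 0 := by linarith
    subst h0 h1
    exact Or.inr (Or.inr (Or.inl ⟨rfl, rfl, -n, by push_cast; linarith⟩))

theorem paramRel_of_paramSet_eq {θ p s θ' p' s' : ℝ} (hp : p ∈ Icc (0 : ℝ) 1)
    (hs : s ∈ Icc (0 : ℝ) 1) (hp' : p' ∈ Icc (0 : ℝ) 1) (hs' : s' ∈ Icc (0 : ℝ) 1)
    (H : paramSet θ p s = paramSet θ' p' s') : ParamRel θ p s θ' p' s' := by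
  rcases eq_or_lt_of_le hs.2 with rfl | h1 <;> rcases eq_or_lt_of_le hs'.2 with rfl | h1'
  · have H' := congrArg (fun K : NonemptyCompacts Circle => (K : Set Circle)) H
    simp only [coe_paramSet_one] at H'
    rw [pair_eq_pair_iff] at H'
    rcases H' with ⟨e1, e2⟩ | ⟨e1, e2⟩
    · obtain ⟨i, hi⟩ := circ_eq_circ.1 e1
      obtain ⟨j, hj⟩ := circ_eq_circ.1 e2
      exact paramRel_of_sub_int hp hp' (m := j - i) (n := -i) (by push_cast; linarith)
        (by push_cast; linarith)
    · obtain ⟨i, hi⟩ := circ_eq_circ.1 e1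
      obtain ⟨j, hj⟩ := circ_eq_circ.1 e2
      exact paramRel_one_of_add_int hp hp' (m := j - i) (n := -j) (by push_cast; linarith)
        (by push_cast; linarith)
  · exact absurd H (paramSet_one_ne hp' ⟨hs'.1, h1'⟩)
  · exact absurd H.symm (paramSet_one_ne hp ⟨hs.1, h1⟩)
  · have k1 := mul_nonneg hs.1 hp.1
    have k2 := mul_nonneg hs.1 (sub_nonneg.2 hp.2)
    have k1' := mul_nonneg hs'.1 hp'.1
    have k2' := mul_nonneg hs'.1 (sub_nonneg.2 hp'.2)
    have key := tripleSet_eq_cases (by linarith) (by linarith) (by linarith) (by linarith)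
      (by linarith) (by linarith) H
    -- `(1 - s) / 3` and `(1 - s') / 3` are both the smallest gap of the same cyclic list.
    have hss : s = s' := by
      rcases key with ⟨e1, e2, -⟩ | ⟨e1, e2, -⟩ | ⟨e1, e2, -⟩ <;> linarith
    subst hss
    rcases eq_or_ne s 0 with rfl | h0
    · refine ⟨rfl, Or.inr (Or.inr (Or.inr (Or.inl ⟨rfl, ?_⟩)))⟩
      rcases key with ⟨-, -, n, e⟩ | ⟨-, -, n, e⟩ | ⟨-, -, n, e⟩
      · exact ⟨3 * n, by push_cast; linarith⟩
      · exact ⟨3 * n + 1, by push_cast; linarith⟩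
      · exact ⟨3 * n - 1, by push_cast; linarith⟩
    -- A nontrivial rotation carries one smallest gap to another, so there is a tie and `p` is an
    -- endpoint.
    · rcases key with ⟨e1, -, n, e⟩ | ⟨e1, e2, n, e⟩ | ⟨e1, e2, n, e⟩
      · have : p' = p := mul_left_cancel₀ h0 (by linarith)
        subst this
        exact ⟨rfl, Or.inl ⟨rfl, n, e⟩⟩
      · have g1 : p = 0 := mul_left_cancel₀ h0 (by linarith)
        have g2 : p' = 1 := mul_left_cancel₀ h0 (by linarith)
        subst g1 g2
        exact ⟨rfl, Or.inr (Or.inl ⟨rfl, rfl, n, by linarith⟩)⟩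
      · have g1 : p = 1 := mul_left_cancel₀ h0 (by linarith)
        have g2 : p' = 0 := mul_left_cancel₀ h0 (by linarith)
        subst g1 g2
        exact ⟨rfl, Or.inr (Or.inr (Or.inl ⟨rfl, rfl, -n, by push_cast; linarith⟩))⟩

/-! ### Coordinates in `ℂ²` through the roots of a quadratic -/

/-- The first coordinate in `ℂ²` of the set with parameters `(θ, p, s)`, up to scaling. -/
noncomputable def coordU (θ p s : ℝ) : ℂ := s * circ (2 * θ + p * (1 + 2 * s) / 3)

/-- The larger root of `X² - 2 w X + u³`, where `(u, w)` are the coordinates of a set. -/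
noncomputable def rootA (θ p s : ℝ) : ℂ := circ (3 * θ + s * p)

/-- The smaller root of `X² - 2 w X + u³`, where `(u, w)` are the coordinates of a set. -/
noncomputable def rootB (θ p s : ℝ) : ℂ := s ^ 3 * circ (3 * θ + (1 + s) * p)

/-- The second coordinate in `ℂ²` of the set with parameters `(θ, p, s)`, up to scaling. -/
noncomputable def coordW (θ p s : ℝ) : ℂ := (rootA θ p s + rootB θ p s) / 2

theorem rootA_mul_rootB (θ p s : ℝ) : rootA θ p s * rootB θ p s = coordU θ p s ^ 3 := by
  unfold rootA rootB coordU
  rw [mul_pow, ← Circle.coe_pow, ← circ_nsmul, mul_left_comm, ← Circle.coe_mul, ← circ_add]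
  congr 4
  push_cast
  ring

theorem norm_rootA (θ p s : ℝ) : ‖rootA θ p s‖ = 1 := by rw [rootA, Circle.norm_coe]

theorem norm_rootB {s : ℝ} (hs : 0 ≤ s) (θ p : ℝ) : ‖rootB θ p s‖ = s ^ 3 := by
  simp [rootB, abs_of_nonneg hs, Circle.norm_coe]

theorem norm_coordU {s : ℝ} (hs : 0 ≤ s) (θ p : ℝ) : ‖coordU θ p s‖ = s := by
  simp [coordU, abs_of_nonneg hs, Circle.norm_coe]

theorem continuous_coe_circ {X : Type*} [TopologicalSpace X] {f : X → ℝ} (hf : Continuous f) :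
    Continuous fun x => (circ (f x) : ℂ) :=
  continuous_subtype_val.comp (continuous_circ.comp hf)

theorem continuous_coordU : Continuous fun q : ℝ × ℝ × ℝ => coordU q.1 q.2.1 q.2.2 := by
  unfold coordU
  exact (Complex.continuous_ofReal.comp (by fun_prop)).mul (continuous_coe_circ (by fun_prop))

theorem continuous_coordW : Continuous fun q : ℝ × ℝ × ℝ => coordW q.1 q.2.1 q.2.2 := by
  unfold coordW rootA rootB
  refine Continuous.div_const (Continuous.add (continuous_coe_circ (by fun_prop)) ?_) _
  exact ((Complex.continuous_ofReal.comp (by fun_prop)).pow 3).mul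
    (continuous_coe_circ (by fun_prop))

/-- The identifications change phases by integers, with two exceptions: at `s = 0` the terms
`coordU` and `rootB` vanish, and the swap at `s = 1` exchanges the two roots, leaving their sum
unchanged. -/
theorem coord_eq_of_paramRel {θ p s θ' p' s' : ℝ} (h : ParamRel θ p s θ' p' s') :
    coordU θ p s = coordU θ' p' s' ∧ coordW θ p s = coordW θ' p' s' := by
  have hper : ∀ {a b : ℝ} (n : ℤ), a = b + n → circ a = circ b :=
    fun n h => circ_eq_circ.2 ⟨n, h⟩
  have glue : ∀ (θ θ' s : ℝ) (n : ℤ), θ' = θ + (1 - s) / 3 + n →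
      coordU θ 0 s = coordU θ' 1 s ∧ coordW θ 0 s = coordW θ' 1 s := by
    intro θ θ' s n h
    unfold coordW coordU rootA rootB
    rw [hper (a := 2 * θ' + 1 * (1 + 2 * s) / 3) (b := 2 * θ + 0 * (1 + 2 * s) / 3) (1 + 2 * n)
        (by push_cast; rw [h]; ring),
      hper (a := 3 * θ' + s * 1) (b := 3 * θ + s * 0) (1 + 3 * n) (by push_cast; rw [h]; ring),
      hper (a := 3 * θ' + (1 + s) * 1) (b := 3 * θ + (1 + s) * 0) (2 + 3 * n)
        (by push_cast; rw [h]; ring)]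
    exact ⟨rfl, rfl⟩
  obtain ⟨rfl, h⟩ := h
  rcases h with ⟨rfl, n, h⟩ | ⟨rfl, rfl, n, h⟩ | ⟨rfl, rfl, n, h⟩ | ⟨rfl, n, h⟩ | ⟨rfl, rfl, n, h⟩
  · unfold coordW coordU rootA rootB
    rw [hper (a := 2 * θ' + p * (1 + 2 * s) / 3) (b := 2 * θ + p * (1 + 2 * s) / 3) (2 * n)
        (by push_cast; rw [h]; ring),
      hper (a := 3 * θ' + s * p) (b := 3 * θ + s * p) (3 * n) (by push_cast; rw [h]; ring),
      hper (a := 3 * θ' + (1 + s) * p) (b := 3 * θ + (1 + s) * p) (3 * n)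
        (by push_cast; rw [h]; ring)]
    exact ⟨rfl, rfl⟩
  · exact glue _ _ _ n h
  · obtain ⟨h1, h2⟩ := glue _ _ _ n h
    exact ⟨h1.symm, h2.symm⟩
  · unfold coordW coordU rootA rootB
    rw [hper (a := 3 * θ' + 0 * p') (b := 3 * θ + 0 * p) n (by linarith)]
    simp
  · unfold coordW coordU rootA rootB
    rw [hper (a := 2 * θ' + (1 - p) * (1 + 2 * 1) / 3) (b := 2 * θ + p * (1 + 2 * 1) / 3)
        (1 + 2 * n) (by push_cast; rw [h]; ring),
      hper (a := 3 * θ' + 1 * (1 - p)) (b := 3 * θ + (1 + 1) * p) (1 + 3 * n)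
        (by push_cast; rw [h]; ring),
      hper (a := 3 * θ' + (1 + 1) * (1 - p)) (b := 3 * θ + 1 * p) (2 + 3 * n)
        (by push_cast; rw [h]; ring)]
    refine ⟨rfl, ?_⟩
    push_cast
    ring

/-- The scaled roots have the same sum and product, so the first `A` is the second `A` or the second
`B`. Norms give `t = t'`, then `s = s'`; in the crossed case they also force `s = 1`. -/
theorem paramRel_of_coord_eq {θ p s t θ' p' s' t' : ℝ} (hp : p ∈ Icc (0 : ℝ) 1)
    (hs : s ∈ Icc (0 : ℝ) 1) (hp' : p' ∈ Icc (0 : ℝ) 1) (hs' : s' ∈ Icc (0 : ℝ) 1)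
    (ht : 0 < t) (ht' : 0 < t')
    (hU : (t : ℂ) ^ 2 * coordU θ p s = (t' : ℂ) ^ 2 * coordU θ' p' s')
    (hW : (t : ℂ) ^ 3 * coordW θ p s = (t' : ℂ) ^ 3 * coordW θ' p' s') :
    ParamRel θ p s θ' p' s' := by
  have hsum : (t : ℂ) ^ 3 * rootA θ p s + (t : ℂ) ^ 3 * rootB θ p s =
      (t' : ℂ) ^ 3 * rootA θ' p' s' + (t' : ℂ) ^ 3 * rootB θ' p' s' := by
    unfold coordW at hW
    linear_combination 2 * hW
  have hprod : ((t : ℂ) ^ 3 * rootA θ p s) * ((t : ℂ) ^ 3 * rootB θ p s) =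
      ((t' : ℂ) ^ 3 * rootA θ' p' s') * ((t' : ℂ) ^ 3 * rootB θ' p' s') := by
    have h1 := rootA_mul_rootB θ p s
    have h2 := rootA_mul_rootB θ' p' s'
    have h3 := congrArg (· ^ 3) hU

    linear_combination (t : ℂ) ^ 6 * h1 - (t' : ℂ) ^ 6 * h2 + h3
  have hfac : ((t : ℂ) ^ 3 * rootA θ p s - (t' : ℂ) ^ 3 * rootA θ' p' s') *
      ((t : ℂ) ^ 3 * rootA θ p s - (t' : ℂ) ^ 3 * rootB θ' p' s') = 0 := by
    linear_combination (t : ℂ) ^ 3 * rootA θ p s * hsum - hprod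
  have hnorm : ∀ x : ℝ, 0 < x → ∀ z : ℂ, ‖(x : ℂ) ^ 3 * z‖ = x ^ 3 * ‖z‖ := fun x hx z => by
    rw [norm_mul, norm_pow, Complex.norm_real, Real.norm_of_nonneg hx.le]
  have hcube : ∀ x y : ℝ, 0 < x → 0 < y → x ^ 3 = y ^ 3 → x = y := fun x y hx hy h =>
    (pow_left_inj₀ hx.le hy.le (by norm_num)).1 h
  have hst : t = t' → s = s' := by
    rintro rfl
    have h := congrArg norm (mul_left_cancel₀ (pow_ne_zero 2 (by exact_mod_cast ht.ne')) hU)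
    rwa [norm_coordU hs.1, norm_coordU hs'.1] at h
  rcases mul_eq_zero.1 hfac with hA | hA
  · rw [sub_eq_zero] at hA
    have h := congrArg norm hA
    rw [hnorm t ht, hnorm t' ht', norm_rootA, norm_rootA, mul_one, mul_one] at h
    obtain rfl := hcube t t' ht ht' h
    obtain rfl := hst rfl
    have hA' := mul_left_cancel₀ (pow_ne_zero 3 (by exact_mod_cast ht.ne')) hA
    have hU' := mul_left_cancel₀ (pow_ne_zero 2 (by exact_mod_cast ht.ne')) hU
    unfold rootA at hA'
    obtain ⟨i, hi⟩ := circ_eq_circ.1 (Circle.coe_injective hA')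
    rcases eq_or_ne s 0 with rfl | h0
    · exact ⟨rfl, Or.inr (Or.inr (Or.inr (Or.inl ⟨rfl, -i, by push_cast; linarith⟩)))⟩
    · unfold coordU at hU'
      have hU'' := mul_left_cancel₀ (by exact_mod_cast h0) hU'
      obtain ⟨j, hj⟩ := circ_eq_circ.1 (Circle.coe_injective hU'')
      -- `p` is three times the phase of `coordU` minus twice the phase of `rootA`.
      exact paramRel_of_sub_int hp hp' (m := 3 * j - 2 * i) (n := j - i)
        (by push_cast; linarith) (by push_cast; linarith)
  · rw [sub_eq_zero] at hA
    have hB : (t : ℂ) ^ 3 * rootB θ p s = (t' : ℂ) ^ 3 * rootA θ' p' s' := by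
      linear_combination hsum - hA
    have h := congrArg norm hA
    have h' := congrArg norm hB
    rw [hnorm t ht, hnorm t' ht', norm_rootA, norm_rootB hs'.1, mul_one] at h
    rw [hnorm t ht, hnorm t' ht', norm_rootA, norm_rootB hs.1, mul_one] at h'
    have hs3 : s ^ 3 ≤ 1 := pow_le_one₀ hs.1 hs.2
    have hs3' : s' ^ 3 ≤ 1 := pow_le_one₀ hs'.1 hs'.2
    have htt : t ^ 3 = t' ^ 3 := by
      have h1 := pow_pos ht 3
      have h2 := pow_pos ht' 3
      apply le_antisymm <;> nlinarith
    obtain rfl := hcube t t' ht ht' htt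
    obtain rfl := hst rfl
    have hs1 : s = 1 := by
      have h1 := pow_pos ht 3
      have h2 : s ^ 3 = 1 := by
        have : t ^ 3 * (s ^ 3 - 1) = 0 := by linarith
        rcases mul_eq_zero.1 this with h | h <;> linarith
      exact (pow_left_inj₀ hs.1 zero_le_one (by norm_num : (3 : ℕ) ≠ 0)).1 (by rw [h2, one_pow])
    subst hs1
    have hA' := mul_left_cancel₀ (pow_ne_zero 3 (by exact_mod_cast ht.ne')) hA
    have hU' := mul_left_cancel₀ (pow_ne_zero 2 (by exact_mod_cast ht.ne')) hU
    unfold rootA rootB at hA'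
    unfold coordU at hU'
    simp only [Complex.ofReal_one, one_pow, one_mul] at hA' hU'
    obtain ⟨i, hi⟩ := circ_eq_circ.1 (Circle.coe_injective hA')
    obtain ⟨j, hj⟩ := circ_eq_circ.1 (Circle.coe_injective hU')
    exact paramRel_one_of_add_int hp hp' (m := 3 * j - 2 * i) (n := i - 2 * j)
      (by push_cast; linarith) (by push_cast; linarith)

theorem exists_norm_mul_circ (z : ℂ) : ∃ φ : ℝ, z = ‖z‖ * circ φ := by
  refine ⟨z.arg / (2 * Real.pi), ?_⟩
  have := Real.pi_pos
  rw [circ, mul_div_cancel₀ _ (by positivity), Circle.coe_exp, Complex.norm_mul_exp_arg_mul_I]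

theorem exists_roots (u w : ℂ) :
    ∃ a b : ℂ, a + b = 2 * w ∧ a * b = u ^ 3 ∧ ‖b‖ ≤ ‖a‖ := by
  obtain ⟨d, hd⟩ := IsAlgClosed.exists_pow_nat_eq (w ^ 2 - u ^ 3) (n := 2) (by norm_num)
  rcases le_total ‖w - d‖ ‖w + d‖ with h | h
  · exact ⟨w + d, w - d, by ring, by linear_combination -hd, h⟩
  · exact ⟨w - d, w + d, by ring, by linear_combination -hd, h⟩

theorem exists_coord_eq {u w : ℂ} (h : u ≠ 0 ∨ w ≠ 0) :
    ∃ θ p s t : ℝ, θ ∈ Icc (0 : ℝ) 1 ∧ p ∈ Icc (0 : ℝ) 1 ∧ s ∈ Icc (0 : ℝ) 1 ∧ 0 < t ∧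
      (t : ℂ) ^ 2 * coordU θ p s = u ∧ (t : ℂ) ^ 3 * coordW θ p s = w := by
  suffices h : ∃ θ p s t : ℝ, p ∈ Icc (0 : ℝ) 1 ∧ s ∈ Icc (0 : ℝ) 1 ∧ 0 < t ∧
      (t : ℂ) ^ 2 * coordU θ p s = u ∧ (t : ℂ) ^ 3 * coordW θ p s = w by
    obtain ⟨θ, p, s, t, hp, hs, ht, hu, hw⟩ := h
    obtain ⟨e1, e2⟩ := coord_eq_of_paramRel (θ := Int.fract θ) (p := p) (s := s) (θ' := θ)
      (p' := p) (s' := s) ⟨rfl, Or.inl ⟨rfl, ⌊θ⌋, (Int.fract_add_floor θ).symm⟩⟩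
    exact ⟨Int.fract θ, p, s, t, ⟨Int.fract_nonneg _, (Int.fract_lt_one _).le⟩, hp, hs, ht,
      by rw [e1, hu], by rw [e2, hw]⟩
  obtain ⟨a, b, hab, hmul, hle⟩ := exists_roots u w
  have ha : a ≠ 0 := by
    rintro rfl
    have hb : b = 0 := by simpa using hle
    subst hb
    have hw : w = 0 := by simpa using hab.symm
    have hu : u = 0 := by simpa using hmul.symm
    simp [hw, hu] at h
  -- This weight makes the larger root a unit.
  obtain ⟨t, ht, hta⟩ : ∃ t : ℝ, 0 < t ∧ t ^ 3 = ‖a‖ := by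
    refine ⟨‖a‖ ^ ((1 : ℝ) / 3), Real.rpow_pos_of_pos (norm_pos_iff.2 ha) _, ?_⟩
    rw [← Real.rpow_natCast, ← Real.rpow_mul (norm_nonneg _)]
    norm_num
  have htc : (t : ℂ) ≠ 0 := by exact_mod_cast ht.ne'
  -- `|u|³ = |a| |b| ≤ |a|² = t⁶`; this will give `s ≤ 1`.
  have hut : ‖u‖ ≤ t ^ 2 := by
    refine le_of_pow_le_pow_left₀ (n := 3) (by norm_num) (by positivity) ?_
    rw [← norm_pow, ← hmul, norm_mul, ← pow_mul, show 2 * 3 = 3 + 3 from rfl, pow_add, hta]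
    gcongr
  obtain ⟨φ, hφ⟩ := exists_norm_mul_circ u
  obtain ⟨ψ, hψ⟩ := exists_norm_mul_circ a
  -- Matching `u` and `a` suffices: `b` is then forced by the product, and `w` by the sum.
  have hfinish : ∀ θ p s : ℝ, (t : ℂ) ^ 2 * coordU θ p s = u → rootA θ p s = circ ψ →
      (t : ℂ) ^ 3 * coordW θ p s = w := by
    intro θ p s hu hA
    have hA' : (t : ℂ) ^ 3 * rootA θ p s = a := by
      rw [hA, hψ, ← hta]; push_cast; rfl
    have hB : (t : ℂ) ^ 3 * rootB θ p s = b := by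
      apply mul_left_cancel₀ ha
      rw [hmul, ← hu]
      nth_rewrite 1 [← hA']
      linear_combination (t : ℂ) ^ 6 * rootA_mul_rootB θ p s
    unfold coordW
    linear_combination (hA' + hB + hab) / 2
  rcases eq_or_ne u 0 with rfl | hu0
  · refine ⟨ψ / 3, 0, 0, t, by simp, by simp, ht, by simp [coordU], ?_⟩
    refine hfinish _ _ _ (by simp [coordU]) ?_
    rw [rootA]
    congr 2
    ring
  · set s := ‖u‖ / t ^ 2 with hs
    set p := Int.fract (3 * φ - 2 * ψ) with hp
    have hp' : p = 3 * φ - 2 * ψ - ⌊3 * φ - 2 * ψ⌋ := rfl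
    have hU : (t : ℂ) ^ 2 * coordU (ψ - φ + p * (1 - s) / 3) p s = u := by
      unfold coordU
      rw [circ_eq_circ.2 ⟨-⌊3 * φ - 2 * ψ⌋, show 2 * (ψ - φ + p * (1 - s) / 3) +
        p * (1 + 2 * s) / 3 = φ + _ by push_cast; linarith⟩]
      conv_rhs => rw [hφ]
      rw [hs]
      push_cast
      field_simp
    refine ⟨ψ - φ + p * (1 - s) / 3, p, s, t, ⟨Int.fract_nonneg _, (Int.fract_lt_one _).le⟩,
      ⟨by positivity, (div_le_one (by positivity)).2 hut⟩, ht, hU, hfinish _ _ _ hU ?_⟩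
    rw [rootA]
    congr 1
    exact circ_eq_circ.2 ⟨-⌊3 * φ - 2 * ψ⌋, by push_cast; linarith⟩

/-! ### Rescaling to the unit sphere -/

/-- The squared norm of the coordinates of a set after rescaling with weight `t`. -/
noncomputable def weightedNorm (q : ℝ × ℝ × ℝ × ℝ) : ℝ :=
  q.2.2.2 ^ 4 * ‖coordU q.1 q.2.1 q.2.2.1‖ ^ 2 + q.2.2.2 ^ 6 * ‖coordW q.1 q.2.1 q.2.2.1‖ ^ 2

theorem continuous_weightedNorm : Continuous weightedNorm := by
  have h : Continuous fun q : ℝ × ℝ × ℝ × ℝ => (q.1, q.2.1, q.2.2.1) := by fun_prop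
  have hU := (continuous_coordU.comp h).norm
  have hW := (continuous_coordW.comp h).norm
  unfold weightedNorm
  exact ((by fun_prop : Continuous fun q : ℝ × ℝ × ℝ × ℝ => q.2.2.2 ^ 4).mul (hU.pow 2)).add
    ((by fun_prop : Continuous fun q : ℝ × ℝ × ℝ × ℝ => q.2.2.2 ^ 6).mul (hW.pow 2))

/-- The parameters `(θ, p, s, t)`, where `t` is the weight that takes the coordinates of the set
with parameters `(θ, p, s)` to the unit sphere. -/
def paramSpace : Set (ℝ × ℝ × ℝ × ℝ) :=
  Icc 0 1 ×ˢ Icc 0 1 ×ˢ Icc 0 1 ×ˢ Icc 0 2 ∩ {q | weightedNorm q = 1}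

theorem isCompact_paramSpace : IsCompact paramSpace :=
  (isCompact_Icc.prod (isCompact_Icc.prod (isCompact_Icc.prod isCompact_Icc))).inter_right
    (isClosed_singleton.preimage continuous_weightedNorm)

/-- Makes the bound `t ≤ 2` in `paramSpace` harmless. As `|w| ≥ (1 - s³) / 2 ≥ (1 - s) / 2`, the
value at `t = 2` is at least `16 s² + 16 (1 - s)² ≥ 8`. -/
theorem one_lt_weightedNorm_two {s : ℝ} (hs : s ∈ Icc (0 : ℝ) 1) (θ p : ℝ) :
    1 < weightedNorm (θ, p, s, 2) := by
  have hs0 := hs.1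
  have hs1 := hs.2
  have hW : (1 - s) / 2 ≤ ‖coordW θ p s‖ := by
    have h := norm_sub_le (rootA θ p s + rootB θ p s) (rootB θ p s)
    rw [add_sub_cancel_right, norm_rootA, norm_rootB hs0] at h
    have h3 : s ^ 3 ≤ s := pow_le_of_le_one hs0 hs1 (by norm_num)
    rw [coordW, norm_div, Complex.norm_ofNat]
    linarith
  have hW2 : ((1 - s) / 2) ^ 2 ≤ ‖coordW θ p s‖ ^ 2 :=
    pow_le_pow_left₀ (by linarith) hW 2
  simp only [weightedNorm, norm_coordU hs0]
  nlinarith [sq_nonneg (2 * s - 1)]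

theorem exists_weight {s : ℝ} (hs : s ∈ Icc (0 : ℝ) 1) (θ p : ℝ) :
    ∃ t ∈ Icc (0 : ℝ) 2, weightedNorm (θ, p, s, t) = 1 := by
  have h := intermediate_value_Icc (f := fun t => weightedNorm (θ, p, s, t)) (a := 0) (b := 2)
    zero_le_two (continuous_weightedNorm.comp (by fun_prop)).continuousOn
  obtain ⟨t, ht, e⟩ := h (show (1 : ℝ) ∈ _ from
    ⟨by simp [weightedNorm], (one_lt_weightedNorm_two hs θ p).le⟩)
  exact ⟨t, ht, e⟩

theorem weight_pos {θ p s t : ℝ} (ht : 0 ≤ t) (h : weightedNorm (θ, p, s, t) = 1) : 0 < t := by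
  refine lt_of_le_of_ne ht ?_
  rintro rfl
  simp [weightedNorm] at h

theorem weight_unique {a b t t' : ℝ} (ha : 0 ≤ a) (hb : 0 ≤ b) (ht : 0 < t) (ht' : 0 < t')
    (h : t ^ 4 * a + t ^ 6 * b = 1) (h' : t' ^ 4 * a + t' ^ 6 * b = 1) : t = t' := by
  have key : ∀ x y : ℝ, 0 < x → x ^ 4 * a + x ^ 6 * b = 1 → y ^ 4 * a + y ^ 6 * b = 1 →
      ¬ x < y := by
    intro x y hx ex ey hxy
    have h4 : x ^ 4 < y ^ 4 := pow_lt_pow_left₀ hxy hx.le (by norm_num)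
    have h6 : x ^ 6 < y ^ 6 := pow_lt_pow_left₀ hxy hx.le (by norm_num)
    have h1 := mul_nonneg (sub_pos.2 h4).le ha
    have h2 := mul_nonneg (sub_pos.2 h6).le hb
    have ha' : (y ^ 4 - x ^ 4) * a = 0 := by linarith
    have hb' : (y ^ 6 - x ^ 6) * b = 0 := by linarith
    have ha0 : a = 0 := (mul_eq_zero.1 ha').resolve_left (by linarith)
    have hb0 : b = 0 := (mul_eq_zero.1 hb').resolve_left (by linarith)
    simp [ha0, hb0] at ex
  exact le_antisymm (not_lt.1 (key t' t ht' h' h)) (not_lt.1 (key t t' ht h h'))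

theorem toLp_mem_S3 {u w : ℂ} : (!₂[u, w] : EuclideanSpace ℂ (Fin 2)) ∈ S3 ↔
    ‖u‖ ^ 2 + ‖w‖ ^ 2 = 1 := by
  rw [mem_sphere_zero_iff_norm, EuclideanSpace.norm_eq, Real.sqrt_eq_one]
  simp

theorem norm_scaled_sq {t : ℝ} (u w : ℂ) :
    ‖(t : ℂ) ^ 2 * u‖ ^ 2 + ‖(t : ℂ) ^ 3 * w‖ ^ 2 = t ^ 4 * ‖u‖ ^ 2 + t ^ 6 * ‖w‖ ^ 2 := by
  have h2 : (|t| ^ 2) ^ 2 = t ^ 4 := by rw [← pow_mul]; exact Even.pow_abs (by decide) t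
  have h3 : (|t| ^ 3) ^ 2 = t ^ 6 := by rw [← pow_mul]; exact Even.pow_abs (by decide) t
  rw [norm_mul, norm_mul, norm_pow, norm_pow, Complex.norm_real, Real.norm_eq_abs, mul_pow,
    mul_pow, h2, h3]

/-- The set described by a parameter. -/
noncomputable def paramToSub (q : paramSpace) : FinSub 3 Circle :=
  ⟨paramSet q.1.1 q.1.2.1 q.1.2.2.1, tripleSet_mem _ _ _⟩

/-- The point of the sphere described by a parameter. -/
noncomputable def paramToSphere (q : paramSpace) : S3 :=
  ⟨!₂[(q.1.2.2.2 : ℂ) ^ 2 * coordU q.1.1 q.1.2.1 q.1.2.2.1,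
      (q.1.2.2.2 : ℂ) ^ 3 * coordW q.1.1 q.1.2.1 q.1.2.2.1],
    toLp_mem_S3.2 ((norm_scaled_sq _ _).trans q.2.2)⟩

theorem continuous_paramToSub : Continuous paramToSub :=
  Continuous.subtype_mk (continuous_paramSet.comp
    (by fun_prop : Continuous fun q : paramSpace => (q.1.1, q.1.2.1, q.1.2.2.1))) _

theorem continuous_paramToSphere : Continuous paramToSphere := by
  have h : Continuous fun q : paramSpace => (q.1.1, q.1.2.1, q.1.2.2.1) := by fun_prop
  have hU := continuous_coordU.comp h
  have hW := continuous_coordW.comp h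
  have ht : Continuous fun q : paramSpace => (q.1.2.2.2 : ℂ) :=
    Complex.continuous_ofReal.comp (by fun_prop)
  refine Continuous.subtype_mk ((PiLp.continuous_toLp 2 _).comp (continuous_pi fun i => ?_)) _
  fin_cases i
  · exact (ht.pow 2).mul hU
  · exact (ht.pow 3).mul hW

theorem surjective_paramToSub : Function.Surjective paramToSub := by
  rintro ⟨K, hK⟩
  obtain ⟨θ, p, s, hθ, hp, hs, h⟩ := exists_paramSet_eq hK
  obtain ⟨t, ht, e⟩ := exists_weight hs θ p
  exact ⟨⟨(θ, p, s, t), ⟨hθ, hp, hs, ht⟩, e⟩, Subtype.ext h⟩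

theorem surjective_paramToSphere : Function.Surjective paramToSphere := by
  rintro ⟨v, hv⟩
  obtain ⟨u, w, rfl⟩ : ∃ u w : ℂ, v = !₂[u, w] :=
    ⟨v 0, v 1, by ext i; fin_cases i <;> simp⟩
  have hv' := toLp_mem_S3.1 hv
  have h0 : u ≠ 0 ∨ w ≠ 0 := by
    by_contra! h
    simp [h.1, h.2] at hv'
  obtain ⟨θ, p, s, t, hθ, hp, hs, ht, rfl, rfl⟩ := exists_coord_eq h0
  have e : weightedNorm (θ, p, s, t) = 1 := (norm_scaled_sq _ _).symm.trans hv'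
  have ht2 : t ≤ 2 := by
    by_contra! h2
    have h := one_lt_weightedNorm_two hs θ p
    rw [← e] at h
    refine absurd h (not_lt.2 ?_)
    unfold weightedNorm
    gcongr
  exact ⟨⟨(θ, p, s, t), ⟨hθ, hp, hs, ht.le, ht2⟩, e⟩, rfl⟩

/-- Both equalities amount to `ParamRel`; the weight is no extra freedom, since the coordinates
determine it. -/
theorem paramToSub_eq_iff (q q' : paramSpace) :
    paramToSub q = paramToSub q' ↔ paramToSphere q = paramToSphere q' := by
  obtain ⟨⟨θ, p, s, t⟩, ⟨-, hp, hs, ht⟩, e⟩ := q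
  obtain ⟨⟨θ', p', s', t'⟩, ⟨-, hp', hs', ht'⟩, e'⟩ := q'
  have htp := weight_pos ht.1 e
  have htp' := weight_pos ht'.1 e'
  constructor
  · intro h
    obtain ⟨h1, h2⟩ := coord_eq_of_paramRel
      (paramRel_of_paramSet_eq hp hs hp' hs' (congrArg Subtype.val h))
    have e2 : t' ^ 4 * ‖coordU θ p s‖ ^ 2 + t' ^ 6 * ‖coordW θ p s‖ ^ 2 = 1 := by
      rw [h1, h2]; exact e'
    have htt : t = t' := weight_unique (by positivity) (by positivity) htp htp' e e2
    subst htt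
    simp only [paramToSphere, h1, h2]
  · intro h
    have h' := congrArg Subtype.val h
    have hU := congrFun (congrArg WithLp.ofLp h') 0
    have hW := congrFun (congrArg WithLp.ofLp h') 1
    exact Subtype.ext (paramSet_eq_of_paramRel
      (paramRel_of_coord_eq hp hs hp' hs' htp htp' hU hW))

/-! ### One-point sets and the trefoil -/

theorem mem_finSub_one {K : NonemptyCompacts Circle} :
    K ∈ FinSub 1 Circle ↔ ∃ x, (K : Set Circle) = {x} := by
  have h0 : (K : Set Circle).encard ≠ 0 := by simpa using K.nonempty.ne_empty
  rw [← encard_eq_one]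
  change (K : Set Circle).encard ≤ (1 : ℕ) ↔ _
  rw [Nat.cast_one]
  refine ⟨fun h => le_antisymm h (Order.one_le_iff_ne_zero.2 h0), fun h => h.le⟩

theorem mem_finSub_two {K : NonemptyCompacts Circle} :
    K ∈ FinSub 2 Circle ↔ ∃ x y, (K : Set Circle) = {x, y} := by
  have h0 : (K : Set Circle).encard ≠ 0 := by simpa using K.nonempty.ne_empty
  change (K : Set Circle).encard ≤ (2 : ℕ) ↔ _
  constructor
  · intro h
    rcases h.lt_or_eq with h | h
    · have h1 : (K : Set Circle).encard ≤ 1 := Order.le_of_lt_add_one (h.trans_eq (by norm_num))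
      obtain ⟨x, hx⟩ := encard_eq_one.1 (le_antisymm h1 (Order.one_le_iff_ne_zero.2 h0))
      exact ⟨x, x, by simp [hx]⟩
    · obtain ⟨x, y, -, hx⟩ := encard_eq_two.1 h
      exact ⟨x, y, hx⟩
  · rintro ⟨x, y, h⟩
    rw [h]
    refine (encard_insert_le _ _).trans ?_
    rw [encard_singleton]
    norm_num

/-- The trefoil equation is invariant under the weights and says that the quadratic has a double
root. As `|A| = 1` and `|B| = s³`, this means `s = 1` and, comparing phases, `p` an integer: the
points `θ` and `θ + p` coincide. -/
theorem paramToSub_mem_finSub_one_iff (q : paramSpace) :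
    (paramToSub q : NonemptyCompacts Circle) ∈ FinSub 1 Circle ↔
      paramToSphere q ∈ trefoilKnot := by
  obtain ⟨⟨θ, p, s, t⟩, ⟨-, hp, hs, ht⟩, e⟩ := q
  have htp := weight_pos ht.1 e
  have htc : (t : ℂ) ≠ 0 := by exact_mod_cast htp.ne'
  have htref : paramToSphere ⟨(θ, p, s, t), ⟨‹_›, hp, hs, ht⟩, e⟩ ∈ trefoilKnot ↔
      rootA θ p s = rootB θ p s := by
    change ((t : ℂ) ^ 2 * coordU θ p s) ^ 3 = ((t : ℂ) ^ 3 * coordW θ p s) ^ 2 ↔ _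
    have h := rootA_mul_rootB θ p s
    rw [mul_pow, mul_pow, ← pow_mul, ← pow_mul, mul_right_inj' (pow_ne_zero _ htc), ← h, coordW,
      ← sub_eq_zero (b := rootB θ p s), ← sq_eq_zero_iff (a := _ - _)]
    constructor <;> intro h'
    · linear_combination -4 * h'
    · linear_combination -h' / 4
  rw [htref, mem_finSub_one]
  change (∃ x, (paramSet θ p s : Set Circle) = {x}) ↔ _
  constructor
  · rintro ⟨x, hx⟩
    obtain ⟨φ, -, rfl⟩ := exists_circ_eq x
    have h1 : paramSet φ 0 1 = paramSet θ p s := by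
      apply SetLike.coe_injective
      rw [hx, coe_paramSet_one]
      simp
    have hs1 : s = 1 := by
      by_contra hne
      exact paramSet_one_ne hp ⟨hs.1, lt_of_le_of_ne hs.2 hne⟩ h1
    subst hs1
    rw [coe_paramSet_one, ← pair_eq_singleton (circ φ), pair_eq_pair_iff] at hx
    have hx' : circ θ = circ (θ + p) := by
      rcases hx with ⟨a, b⟩ | ⟨a, b⟩ <;> rw [a, b]
    obtain ⟨n, hn⟩ := circ_eq_circ.1 hx'
    rw [rootA, rootB, circ_eq_circ.2 ⟨n, show 3 * θ + 1 * p = 3 * θ + (1 + 1) * p + n by linarith⟩]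
    simp
  · intro h
    have hn := congrArg norm h
    rw [norm_rootA, norm_rootB hs.1] at hn
    have hs1 : s = 1 :=
      (pow_left_inj₀ hs.1 zero_le_one (by norm_num : (3 : ℕ) ≠ 0)).1 (by rw [← hn, one_pow])
    subst hs1
    simp only [rootA, rootB, Complex.ofReal_one, one_pow, one_mul] at h
    obtain ⟨n, hn⟩ := circ_eq_circ.1 (Circle.coe_injective h)
    refine ⟨circ θ, ?_⟩
    rw [coe_paramSet_one, circ_eq_circ.2 ⟨-n, show θ + p = θ + _ by push_cast; linarith⟩,
      pair_eq_singleton]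

/-! ### Sets of at most two points and the Möbius band -/

/-- The parametrization of the subsets with at most two elements by the unit square. -/
noncomputable def squareToSub (q : unitInterval × unitInterval) : FinSub 3 Circle :=
  ⟨tripleSet (((q.1 : ℝ) - q.2) / 2) q.2 0, tripleSet_mem _ _ _⟩

theorem coe_squareToSub (q : unitInterval × unitInterval) :
    ((squareToSub q : NonemptyCompacts Circle) : Set Circle) =
      {circ (((q.1 : ℝ) - q.2) / 2), circ (((q.1 : ℝ) + q.2) / 2)} := by
  rw [squareToSub, coe_tripleSet, sub_zero,
    show ((q.1 : ℝ) - q.2) / 2 + q.2 = ((q.1 : ℝ) + q.2) / 2 by ring]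
  grind

theorem continuous_squareToSub : Continuous squareToSub := by
  have hc := continuous_circ
  have hs := NonemptyCompacts.continuous_singleton (α := Circle)
  refine Continuous.subtype_mk ?_ _
  unfold tripleSet
  exact ((hs.comp (hc.comp (by fun_prop))).sup (hs.comp (hc.comp (by fun_prop)))).sup
    (hs.comp (hc.comp (by fun_prop)))

/-- `(x, y)` stands for the arc with midpoint `x / 2` and length `y`. The complementary arc has the
same ends, the opposite midpoint and length `1 - y`. -/
theorem squareToSub_eq_of_glue {q q' : unitInterval × unitInterval} (h : MoebiusGlue q q') :
    squareToSub q = squareToSub q' := by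
  obtain ⟨x, y⟩ := q
  obtain ⟨x', y'⟩ := q'
  obtain ⟨rfl, rfl, rfl⟩ : x = 0 ∧ x' = 1 ∧ y' = unitInterval.symm y := h
  apply Subtype.ext
  apply SetLike.coe_injective
  rw [coe_squareToSub, coe_squareToSub]
  simp only [unitInterval.coe_symm_eq, Icc.coe_zero, Icc.coe_one]
  rw [circ_eq_circ.2 ⟨-1, show ((0 : ℝ) - y) / 2 = (1 + (1 - y)) / 2 + _ by push_cast; ring⟩,
    show ((0 : ℝ) + y) / 2 = (1 - (1 - y)) / 2 by ring, pair_comm]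

theorem eq_or_glue_of_squareToSub_eq {q q' : unitInterval × unitInterval}
    (h : squareToSub q = squareToSub q') :
    q = q' ∨ MoebiusGlue q q' ∨ MoebiusGlue q' q := by
  obtain ⟨⟨x, hx0, hx1⟩, ⟨y, hy0, hy1⟩⟩ := q
  obtain ⟨⟨x', hx0', hx1'⟩, ⟨y', hy0', hy1'⟩⟩ := q'
  have h' := congrArg (fun K : FinSub 3 Circle => ((K : NonemptyCompacts Circle) : Set Circle)) h
  simp only [coe_squareToSub, pair_eq_pair_iff] at h'
  simp only [MoebiusGlue, Prod.mk.injEq, Subtype.ext_iff, unitInterval.coe_symm_eq, Icc.coe_zero,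
    Icc.coe_one]
  have bound : ∀ n : ℤ, (-1 : ℝ) ≤ n → (n : ℝ) ≤ 1 → n = -1 ∨ n = 0 ∨ n = 1 := by
    intro n h1 h2
    have h1' : -1 ≤ n := by exact_mod_cast h1
    have h2' : n ≤ 1 := by exact_mod_cast h2
    omega
  rcases h' with ⟨a, b⟩ | ⟨a, b⟩
  · obtain ⟨i, hi⟩ := circ_eq_circ.1 a
    obtain ⟨j, hj⟩ := circ_eq_circ.1 b
    have e1 : ((i + j : ℤ) : ℝ) = x - x' := by push_cast; linarith
    have e2 : ((j - i : ℤ) : ℝ) = y - y' := by push_cast; linarith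
    rcases bound (i + j) (by linarith) (by linarith) with h1 | h1 | h1 <;>
      rcases bound (j - i) (by linarith) (by linarith) with h2 | h2 | h2 <;>
      first
      -- `i + j` and `j - i` have equal parity, which excludes the mixed cases.
      | omega
      | (rw [h1] at e1
         rw [h2] at e2
         push_cast at e1 e2
         first
         | exact Or.inl ⟨by linarith, by linarith⟩
         | exact Or.inr (Or.inl ⟨by linarith, by linarith, by linarith⟩)
         | exact Or.inr (Or.inr ⟨by linarith, by linarith, by linarith⟩))
  · obtain ⟨i, hi⟩ := circ_eq_circ.1 a
    obtain ⟨j, hj⟩ := circ_eq_circ.1 b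
    have e1 : ((i + j : ℤ) : ℝ) = x - x' := by push_cast; linarith
    -- Subtracting 1 centres `y + y'` in `[-1, 1]`, so that `bound` applies.
    have e2 : ((j - i - 1 : ℤ) : ℝ) = y + y' - 1 := by push_cast; linarith
    rcases bound (i + j) (by linarith) (by linarith) with h1 | h1 | h1 <;>
      rcases bound (j - i - 1) (by linarith) (by linarith) with h2 | h2 | h2 <;>
      first
      | omega
      | (rw [h1] at e1
         rw [h2] at e2
         push_cast at e1 e2
         first
         | exact Or.inl ⟨by linarith, by linarith⟩
         | exact Or.inr (Or.inl ⟨by linarith, by linarith, by linarith⟩)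
         | exact Or.inr (Or.inr ⟨by linarith, by linarith, by linarith⟩))

/-- The map from the Möbius band to `Sub_3` induced by the parametrization by the square. -/
noncomputable def moebiusToSub : MoebiusBand → FinSub 3 Circle :=
  Quot.lift squareToSub fun _ _ => squareToSub_eq_of_glue

theorem isEmbedding_moebiusToSub : IsEmbedding moebiusToSub := by
  have : CompactSpace MoebiusBand := inferInstanceAs (CompactSpace (Quot MoebiusGlue))
  have hcont : Continuous moebiusToSub := continuous_quot_lift _ continuous_squareToSub
  refine (hcont.isClosedEmbedding ?_).isEmbedding
  rintro ⟨q⟩ ⟨q'⟩ h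
  rcases eq_or_glue_of_squareToSub_eq h with rfl | h | h
  · rfl
  · exact Quot.sound h
  · exact (Quot.sound h).symm

theorem exists_squareToSub_eq_of_le {a b : ℝ} (ha : 0 ≤ a) (hab : a ≤ b) (hb : b < 1) :
    ∃ q, ((squareToSub q : NonemptyCompacts Circle) : Set Circle) = {circ a, circ b} := by
  rcases le_total (a + b) 1 with h | h
  · refine ⟨(⟨a + b, by linarith, h⟩, ⟨b - a, by linarith, by linarith⟩), ?_⟩
    rw [coe_squareToSub]
    congr 3 <;> ring
  -- Past midpoint `1 / 2`, the complementary arc is used instead.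
  · refine ⟨(⟨a + b - 1, by linarith, by linarith⟩, ⟨1 - (b - a), by linarith, by linarith⟩), ?_⟩
    rw [coe_squareToSub, pair_comm]
    congr 2
    · ring_nf
    · exact circ_eq_circ.2 ⟨-1, by push_cast; ring⟩

theorem range_moebiusToSub :
    range moebiusToSub = {K : FinSub 3 Circle | (K : NonemptyCompacts Circle) ∈ FinSub 2 Circle} := by
  ext K
  constructor
  · rintro ⟨⟨q⟩, rfl⟩
    exact mem_finSub_two.2 ⟨_, _, coe_squareToSub q⟩
  · intro hK
    obtain ⟨x, y, h⟩ := mem_finSub_two.1 hK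
    obtain ⟨a, ha, rfl⟩ := exists_circ_eq x
    obtain ⟨b, hb, rfl⟩ := exists_circ_eq y
    obtain ⟨q, hq⟩ : ∃ q, ((squareToSub q : NonemptyCompacts Circle) : Set Circle) =
        {circ a, circ b} := by
      rcases le_total a b with hab | hab
      · exact exists_squareToSub_eq_of_le ha.1 hab hb.2
      · rw [pair_comm]
        exact exists_squareToSub_eq_of_le hb.1 hab ha.2
    exact ⟨Quot.mk _ q, Subtype.ext (SetLike.coe_injective (hq.trans h.symm))⟩

theorem moebiusToSub_image_boundary :
    moebiusToSub '' moebiusBoundary =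
      {K : FinSub 3 Circle | (K : NonemptyCompacts Circle) ∈ FinSub 1 Circle} := by
  ext K
  constructor
  · rintro ⟨_, ⟨⟨x, y⟩, hy, rfl⟩, rfl⟩
    refine mem_finSub_one.2 ⟨circ (((x : ℝ) + y) / 2), (coe_squareToSub (x, y)).trans ?_⟩
    have hxy : circ (((x : ℝ) - y) / 2) = circ (((x : ℝ) + y) / 2) := by
      rcases hy with rfl | rfl
      · simp
      · exact circ_eq_circ.2 ⟨-1, by push_cast [Icc.coe_one]; ring⟩
    simp only [hxy, pair_eq_singleton]
  · intro hK
    obtain ⟨x, h⟩ := mem_finSub_one.1 hK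
    obtain ⟨a, ha, rfl⟩ := exists_circ_eq x
    have ha0 := ha.1
    have ha1 := ha.2
    -- The edge `y = 0` (arcs of length zero) covers the first half of the circle, the edge `y = 1`
    -- (full turns) the second.
    rcases le_total (2 * a) 1 with h2 | h2
    · refine ⟨_, ⟨(⟨2 * a, by linarith, h2⟩, 0), Or.inl rfl, rfl⟩, ?_⟩
      refine Subtype.ext (SetLike.coe_injective ((coe_squareToSub _).trans ?_))
      rw [h]
      simp
    · refine ⟨_, ⟨(⟨2 * a - 1, by linarith, by linarith⟩, 1), Or.inr rfl, rfl⟩, ?_⟩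
      refine Subtype.ext (SetLike.coe_injective ((coe_squareToSub _).trans ?_))
      rw [h, ← pair_eq_singleton (circ a)]
      simp only [Icc.coe_one]
      rw [circ_eq_circ.2 ⟨-1, show (2 * a - 1 - 1) / 2 = a + _ by push_cast; ring⟩]
      congr 3
      ring

theorem mainTheorem3 :
    ∃ h : FinSub 3 Circle ≃ₜ S3,
      h '' {K | (K : NonemptyCompacts Circle) ∈ FinSub 1 Circle} = trefoilKnot ∧
      ∃ f : MoebiusBand → S3, IsEmbedding f ∧
        range f = h '' {K | (K : NonemptyCompacts Circle) ∈ FinSub 2 Circle} ∧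
        f '' moebiusBoundary = trefoilKnot := by
  have : CompactSpace paramSpace := isCompact_iff_compactSpace.1 isCompact_paramSpace
  obtain ⟨h, hh⟩ := exists_homeomorph_of_ker_eq continuous_paramToSub continuous_paramToSphere
    surjective_paramToSub surjective_paramToSphere paramToSub_eq_iff
  have htrefoil : h '' {K | (K : NonemptyCompacts Circle) ∈ FinSub 1 Circle} = trefoilKnot := by
    ext v
    constructor
    · rintro ⟨K, hK, rfl⟩
      obtain ⟨q, rfl⟩ := surjective_paramToSub K
      rw [hh]
      exact (paramToSub_mem_finSub_one_iff q).1 hK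
    · intro hv
      obtain ⟨q, rfl⟩ := surjective_paramToSphere v
      exact ⟨paramToSub q, (paramToSub_mem_finSub_one_iff q).2 hv, hh q⟩
  refine ⟨h, htrefoil, h ∘ moebiusToSub, h.isEmbedding.comp isEmbedding_moebiusToSub, ?_, ?_⟩
  · rw [range_comp, range_moebiusToSub]
  · rw [image_comp, moebiusToSub_image_boundary, htrefoil]
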